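/- **Theorem 3.3.** For every integer $n\ge 1$ let $Z_1,Z_2,Z_3,\dots$ (depending on $n$) be independent random variables, each uniformly distributed on $N_n=\{1,2,\dots,n\}$. For $j\in N_n$ let $$X_{nj}=\min\{i\ge 2 : Z_{i-1}=Z_i=j\}$$ be the waiting time until the pair $jj$ occurs as a run ($X_{nj}=\infty$ if it never occurs). Let $M_n^{(k)}$, $1\le k\le n$, be the $k$-th largest of $X_{n1},\dots,X_{nn}$, let $M_n=M_n^{(1)}=\max\{X_{n1},\dots,X_{nn}\}$, and for $1\le a\le n$ let $S_{n,a}$ be the waiting time until $a$ different pairs among $11,22,\dots,nn$ have occurred, i.e. the least $m$ such that $a$ of them occur as runs within $Z_1,\dots,Z_m$ ($\infty$ if there is no such $m$). Let $k$ be a fixed positive integer. Then $S_{n,n-k+1}=M_n^{(k)}$ for every $n\ge k$, and for every real $x$ $$\lim_{n\to\infty}P\{M_n^{(k)}\le n^2(x+\ln n)\}=e^{-e^{-x}}\sum_{s=0}^{k-1}\frac{e^{-sx}}{s!}.$$ In particular, the time $M_n=S_{n,n}$ until all $n$ pairs have occurred has asymptotically the Gumbel extreme value distribution: for every real $x$,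 $$\lim_{n\to\infty}P\{M_n\le n^2(x+\ln n)\}=e^{-e^{-x}}.$$ -/

import Mathlib

open MeasureTheory ProbabilityTheory Filter Topology

noncomputable section

namespace PairCollector

/-- The pair `jj` occurs as a run in the sequence `z 1, z 2, z 3, …` with second draw number `k`,
i.e. `z (k - 1) = z k = j`.  Draws are numbered from `1`, so `k ≥ 2`; the value `z 0` is ignored. -/
def PairAt (z : ℕ → ℕ) (j k : ℕ) : Prop :=
  2 ≤ k ∧ z (k - 1) = j ∧ z k = j

/-- The waiting time `X_j = min {k : z (k - 1) = z k = j}` for the pair `jj`;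
it is `⊤` if the pair never occurs. -/
def pairTime (z : ℕ → ℕ) (j : ℕ) : ℕ∞ :=
  ⨅ (k : ℕ) (_ : PairAt z j k), (k : ℕ∞)

/-- The `k`-th largest (`1 ≤ k ≤ n`, counted with multiplicity) of `x 1, …, x n`: the entry
number `k` of the list of these values sorted in decreasing order.  The value `0` is returned
when `n < k`. -/
def kthLargest (n k : ℕ) (x : ℕ → ℕ∞) : ℕ∞ :=
  (((Finset.Icc 1 n).val.map x).sort (· ≥ ·)).getD (k - 1) 0

/-- `M_n^{(k)}`: the `k`-th largest of the waiting times for the pairs `11, 22, …, nn`. -/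
def kthMaxTime (n k : ℕ) (z : ℕ → ℕ) : ℕ∞ :=
  kthLargest n k (pairTime z)

/-- `M_n`: the maximum of the waiting times for the pairs `11, 22, …, nn`. -/
def maxTime (n : ℕ) (z : ℕ → ℕ) : ℕ∞ :=
  (Finset.Icc 1 n).sup (pairTime z)

open Classical in
/-- The number of different pairs `jj`, `1 ≤ j ≤ n`, that occur within the first `m` draws. -/
def numPairs (n m : ℕ) (z : ℕ → ℕ) : ℕ :=
  ((Finset.Icc 1 n).filter (fun j => ∃ k ≤ m, PairAt z j k)).card

/-- `S_{n,a}`: the waiting time until `a` of the pairs `jj`, `1 ≤ j ≤ n`, have occurred;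
it is `⊤` if this never happens. -/
def collectTime (n a : ℕ) (z : ℕ → ℕ) : ℕ∞ :=
  ⨅ (m : ℕ) (_ : a ≤ numPairs n m z), (m : ℕ∞)

/-- `t ≤ u` for an extended natural number `t` and a real number `u`
(in particular `t` is finite). -/
def TimeLE (t : ℕ∞) (u : ℝ) : Prop :=
  ∃ m : ℕ, t = (m : ℕ∞) ∧ (m : ℝ) ≤ u

end PairCollector

end

/-
Let `W` be the number of pairs that have not occurred within the first `m` draws. The `k`-th largest
waiting time is at most `m` if and only if `W < k`. The binomial moment `𝔼[C(W, r)]` is `C(n, r)`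
times the probability that `r` given pairs do not occur, and this probability obeys a second-order
linear recurrence in `m`, which traps it between `(1 - r / n²) ^ m` and, up to a factor tending
to `1`, `(1 - r / (n (n + 1))) ^ m`. For `m = ⌊n² (x + log n)⌋` the binomial moments therefore
converge to `e^(-rx) / r!`, those of the Poisson law of parameter `e^(-x)`, and the Bonferroni
inequalities turn this into convergence of `P(W = s)`.
-/

namespace PairCollector

section WaitingTimes

theorem iInf_natCast_le_natCast_iff (p : ℕ → Prop) (m : ℕ) :
    (⨅ (k : ℕ) (_ : p k), (k : ℕ∞)) ≤ m ↔ ∃ k ≤ m, p k := by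
  constructor
  · contrapose!
    intro h
    rw [← ENat.add_one_le_iff (ENat.natCast_ne_top m)]
    refine le_iInf₂ fun k hk => ?_
    exact_mod_cast not_le.1 fun hkm => h k hkm hk
  · rintro ⟨k, hkm, hk⟩
    exact (iInf₂_le k hk).trans (by exact_mod_cast hkm)

theorem eq_of_forall_le_natCast_iff {a b : ℕ∞} (h : ∀ m : ℕ, a ≤ m ↔ b ≤ m) : a = b := by
  refine le_antisymm ?_ ?_
  · induction b using ENat.recTopCoe with
    | top => exact le_top
    | coe b => exact (h b).2 le_rfl
  · induction a using ENat.recTopCoe with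
    | top => exact le_top
    | coe a => exact (h a).1 le_rfl

theorem pairTime_le_iff (z : ℕ → ℕ) (j m : ℕ) :
    pairTime z j ≤ (m : ℕ∞) ↔ ∃ k ≤ m, PairAt z j k :=
  iInf_natCast_le_natCast_iff _ _

theorem numPairs_mono (n : ℕ) (z : ℕ → ℕ) : Monotone fun m => numPairs n m z := by
  classical
  exact fun l m h => Finset.card_le_card <| Finset.monotone_filter_right _
    fun j _ ⟨k, hk, hp⟩ => ⟨k, hk.trans h, hp⟩

theorem collectTime_le_iff (n a m : ℕ) (z : ℕ → ℕ) :
    collectTime n a z ≤ (m : ℕ∞) ↔ a ≤ numPairs n m z :=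
  (iInf_natCast_le_natCast_iff _ _).trans
    ⟨fun ⟨_, hlm, ha⟩ => ha.trans (numPairs_mono n z hlm), fun h => ⟨m, le_rfl, h⟩⟩

theorem getElem_le_iff_countP_le {α : Type*} [LinearOrder α] {l : List α}
    (hl : l.Pairwise (· ≥ ·)) (c : α) {i : ℕ} (hi : i < l.length) :
    l[i] ≤ c ↔ l.countP (c < ·) ≤ i := by
  induction l generalizing i with
  | nil => simp at hi
  | cons b l ih =>
    rw [List.pairwise_cons] at hl
    have hzero (hb : b ≤ c) : l.countP (c < ·) = 0 :=
      List.countP_eq_zero.2 fun y hy => by simpa using (hl.1 y hy).trans hb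
    rcases i with _ | i
    · rcases le_or_gt b c with hb | hb
      · simp [hzero hb, hb]
      · simp [hb]
    · rw [List.getElem_cons_succ, ih hl.2 (by simpa using hi)]
      rcases le_or_gt b c with hb | hb
      · simp [hzero hb, hb]
      · simp [hb]

theorem kthLargest_le_iff {n k : ℕ} (hk : 1 ≤ k) (hkn : k ≤ n) (x : ℕ → ℕ∞) (c : ℕ∞) :
    kthLargest n k x ≤ c ↔ ((Finset.Icc 1 n).filter (fun j => c < x j)).card < k := by
  unfold kthLargest
  set s := (Finset.Icc 1 n).val.map x with hs
  have hi : k - 1 < (s.sort (· ≥ ·)).length := by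
    simp only [hs, Multiset.length_sort, Multiset.card_map, Finset.card_val, Nat.card_Icc]
    omega
  have hcount : (s.sort (· ≥ ·)).countP (c < ·) =
      ((Finset.Icc 1 n).filter (fun j => c < x j)).card := by
    rw [← Multiset.coe_countP (p := (c < ·)), Multiset.sort_eq, hs, Multiset.countP_map]
    rfl
  rw [List.getD_eq_getElem _ _ hi, getElem_le_iff_countP_le (Multiset.pairwise_sort s _) c hi,
    hcount]
  omega

/-- The number of pairs `jj`, `1 ≤ j ≤ n`, that have not occurred within the first `m` draws. -/
noncomputable def numMissing (n m : ℕ) (z : ℕ → ℕ) : ℕ :=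
  ((Finset.Icc 1 n).filter (fun j => (m : ℕ∞) < pairTime z j)).card

theorem numMissing_add_numPairs (n m : ℕ) (z : ℕ → ℕ) : numMissing n m z + numPairs n m z = n := by
  classical
  have h := Finset.card_filter_add_card_filter_not (s := Finset.Icc 1 n)
    fun j => (m : ℕ∞) < pairTime z j
  simp only [not_lt, pairTime_le_iff, Nat.card_Icc, Nat.add_sub_cancel] at h
  unfold numMissing numPairs
  convert h using 3

theorem kthMaxTime_le_iff {n k : ℕ} (hk : 1 ≤ k) (hkn : k ≤ n) (m : ℕ) (z : ℕ → ℕ) :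
    kthMaxTime n k z ≤ (m : ℕ∞) ↔ numMissing n m z < k :=
  kthLargest_le_iff hk hkn _ _

theorem collectTime_eq_kthMaxTime {n k : ℕ} (hk : 1 ≤ k) (hkn : k ≤ n) (z : ℕ → ℕ) :
    collectTime n (n + 1 - k) z = kthMaxTime n k z := by
  refine eq_of_forall_le_natCast_iff fun m => ?_
  rw [collectTime_le_iff, kthMaxTime_le_iff hk hkn]
  have := numMissing_add_numPairs n m z
  omega

theorem kthMaxTime_one {n : ℕ} (hn : 1 ≤ n) (z : ℕ → ℕ) : kthMaxTime n 1 z = maxTime n z := by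
  refine eq_of_forall_le_natCast_iff fun m => ?_
  rw [kthMaxTime_le_iff le_rfl hn, numMissing, maxTime, Finset.sup_le_iff, Nat.lt_one_iff,
    Finset.card_eq_zero, Finset.filter_eq_empty_iff]
  simp only [not_lt]

theorem timeLE_iff {t : ℕ∞} {u : ℝ} (hu : 0 ≤ u) : TimeLE t u ↔ t ≤ ((⌊u⌋₊ : ℕ) : ℕ∞) := by
  constructor
  · rintro ⟨m, rfl, hm⟩
    exact_mod_cast Nat.le_floor hm
  · intro h
    lift t to ℕ using ne_top_of_le_ne_top (ENat.natCast_ne_top _) h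
    exact ⟨t, rfl, (Nat.le_floor_iff hu).1 (by exact_mod_cast h)⟩

end WaitingTimes

section BinomialMoments

theorem abs_ite_sub_alternating_sum_choose_le (v T : ℕ) :
    |(if v = 0 then 1 else 0) - ∑ t ∈ Finset.range T, (-1 : ℝ) ^ t * v.choose t| ≤ v.choose T := by
  rcases T with _ | T
  · rcases v with _ | v <;> simp
  rcases v with _ | v
  · simp [Finset.sum_range_succ']
  have hsum : ∑ t ∈ Finset.range (T + 1), (-1 : ℝ) ^ t * (v + 1).choose t =
      (-1) ^ T * v.choose T := by
    exact_mod_cast Int.alternating_sum_range_choose_eq_choose (n := v) (m := T)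
  rw [hsum, if_neg v.succ_ne_zero, zero_sub, abs_neg, abs_mul, abs_pow, abs_neg, abs_one, one_pow,
    one_mul, Nat.abs_cast]
  exact_mod_cast Nat.choose_succ_succ v T ▸ Nat.le_add_right _ _

theorem abs_ite_eq_sub_sum_choose_le (w s T : ℕ) :
    |(if w = s then 1 else 0) -
        ∑ t ∈ Finset.range T, (-1 : ℝ) ^ t * (s + t).choose s * w.choose (s + t)| ≤
      (s + T).choose s * w.choose (s + T) := by
  have hmul (t : ℕ) :
      ((s + t).choose s * w.choose (s + t) : ℝ) = w.choose s * (w - s).choose t := by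
    have h := w.choose_mul (s.le_add_right t)
    rw [Nat.add_sub_cancel_left, mul_comm] at h
    exact_mod_cast h
  simp only [mul_assoc, hmul, mul_left_comm _ (w.choose s : ℝ), ← Finset.mul_sum]
  rcases lt_or_ge w s with hws | hsw
  · simp [Nat.choose_eq_zero_of_lt hws, hws.ne]
  have hite : (if w = s then 1 else 0 : ℝ) = w.choose s * if w - s = 0 then 1 else 0 := by
    obtain rfl | h := hsw.eq_or_lt
    · simp
    · rw [if_neg h.ne', if_neg (Nat.sub_pos_of_lt h).ne', mul_zero]
  rw [hite, ← mul_sub, abs_mul, Nat.abs_cast]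
  gcongr
  exact abs_ite_sub_alternating_sum_choose_le _ _

theorem choose_mul_pow_div_factorial (c : ℝ) (s t : ℕ) :
    (s + t).choose s * (c ^ (s + t) / (s + t).factorial) =
      c ^ t / t.factorial * (c ^ s / s.factorial) := by
  have h : ((s + t).factorial : ℝ) = (s + t).choose s * s.factorial * t.factorial := by
    rw [Nat.choose_symm_add]
    exact_mod_cast (Nat.add_choose_mul_factorial_mul_factorial s t).symm
  have : ((s + t).choose s : ℝ) ≠ 0 := by
    exact_mod_cast (Nat.choose_pos (s.le_add_right t)).ne'
  rw [h, pow_add]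
  field_simp

theorem tendsto_of_forall_abs_sub_le {ι : Type*} {l : Filter ι} {a : ι → ℝ} {S e : ℕ → ι → ℝ}
    {σ ε : ℕ → ℝ} {L : ℝ} (ha : ∀ᶠ i in l, ∀ T, |a i - S T i| ≤ e T i)
    (hS : ∀ T, Tendsto (S T) l (𝓝 (σ T))) (he : ∀ T, Tendsto (e T) l (𝓝 (ε T)))
    (hσ : Tendsto σ atTop (𝓝 L)) (hε : Tendsto ε atTop (𝓝 0)) : Tendsto a l (𝓝 L) := by
  refine tendsto_order.2 ⟨fun b hb => ?_, fun b hb => ?_⟩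
  · obtain ⟨T, hT⟩ : ∃ T, b < σ T - ε T := by
      have h : Tendsto (fun T => σ T - ε T) atTop (𝓝 L) := by simpa using hσ.sub hε
      exact (h.eventually_const_lt hb).exists
    filter_upwards [ha, ((hS T).sub (he T)).eventually_const_lt hT] with i hi hlt
    linarith [neg_le_of_abs_le (hi T)]
  · obtain ⟨T, hT⟩ : ∃ T, σ T + ε T < b := by
      have h : Tendsto (fun T => σ T + ε T) atTop (𝓝 L) := by simpa using hσ.add hε
      exact (h.eventually_lt_const hb).exists
    filter_upwards [ha, ((hS T).add (he T)).eventually_lt_const hT] with i hi hlt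
    linarith [le_of_abs_le (hi T)]

theorem integral_indicator_one₀ {Ω : Type*} [MeasurableSpace Ω] {μ : Measure Ω} {s : Set Ω}
    (hs : NullMeasurableSet s μ) : ∫ ω, s.indicator (1 : Ω → ℝ) ω ∂μ = μ.real s := by
  simp [integral_indicator₀ hs]

theorem nullMeasurableSet_eq_of_integrable_choose {Ω : Type*} [MeasurableSpace Ω] {μ : Measure Ω}
    {W : Ω → ℕ} (hW : ∀ r, Integrable (fun ω => ((W ω).choose r : ℝ)) μ) (s : ℕ) :
    NullMeasurableSet {ω | W ω = s} μ := by
  have h : AEMeasurable (fun ω => (W ω : ℝ)) μ := by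
    simpa only [Nat.choose_one_right] using (hW 1).aemeasurable
  simpa [Set.preimage] using h.nullMeasurable (measurableSet_singleton (s : ℝ))

theorem abs_measureReal_eq_sub_sum_le {Ω : Type*} [MeasurableSpace Ω] {μ : Measure Ω}
    {W : Ω → ℕ} (hW : ∀ r, Integrable (fun ω => ((W ω).choose r : ℝ)) μ) (s T : ℕ) :
    |μ.real {ω | W ω = s} - ∑ t ∈ Finset.range T,
        (-1 : ℝ) ^ t * (s + t).choose s * ∫ ω, ((W ω).choose (s + t) : ℝ) ∂μ| ≤
      (s + T).choose s * ∫ ω, ((W ω).choose (s + T) : ℝ) ∂μ := by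
  have hs := nullMeasurableSet_eq_of_integrable_choose hW s
  have hterm (t : ℕ) := (hW (s + t)).const_mul ((-1 : ℝ) ^ t * (s + t).choose s)
  have hind : Integrable ({ω | W ω = s}.indicator (1 : Ω → ℝ)) μ :=
    (hW s).mono' (aemeasurable_one.indicator₀ hs).aestronglyMeasurable <|
      .of_forall fun ω => by
        by_cases h : W ω = s <;> simp [h]
  simp only [← integral_indicator_one₀ hs, ← integral_const_mul]
  rw [← integral_finsetSum _ fun t _ => hterm t,
    ← integral_sub hind (integrable_finsetSum _ fun t _ => hterm t), ← Real.norm_eq_abs]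
  refine norm_integral_le_of_norm_le ((hW (s + T)).const_mul _) (.of_forall fun ω => ?_)
  have h := abs_ite_eq_sub_sum_choose_le (W ω) s T
  simpa only [Set.indicator_apply, Set.mem_ofPred_eq, Pi.one_apply, Real.norm_eq_abs] using h

variable {ι : Type*} {l : Filter ι} {Ω : ι → Type*} [∀ i, MeasurableSpace (Ω i)]
  {P : ∀ i, Measure (Ω i)} {W : ∀ i, Ω i → ℕ} {c : ℝ}

theorem tendsto_measureReal_eq_of_tendsto_integral_choose
    (hW : ∀ᶠ i in l, ∀ r, Integrable (fun ω => ((W i ω).choose r : ℝ)) (P i))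
    (hlim : ∀ r, Tendsto (fun i => ∫ ω, ((W i ω).choose r : ℝ) ∂P i) l
      (𝓝 (c ^ r / r.factorial))) (s : ℕ) :
    Tendsto (fun i => (P i).real {ω | W i ω = s}) l
      (𝓝 (Real.exp (-c) * (c ^ s / s.factorial))) := by
  refine tendsto_of_forall_abs_sub_le
    (hW.mono fun i hi => abs_measureReal_eq_sub_sum_le hi s)
    (fun T => tendsto_finsetSum _ fun t _ => (hlim (s + t)).const_mul _)
    (fun T => (hlim (s + T)).const_mul _) ?_ ?_
  · have hexp := (NormedSpace.expSeries_div_hasSum_exp (-c)).mul_right (c ^ s / s.factorial)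
    rw [← Real.exp_eq_exp_ℝ] at hexp
    convert hexp.tendsto_sum_nat using 3 with T t
    rw [mul_assoc, choose_mul_pow_div_factorial, neg_pow c]
    ring
  · simp only [choose_mul_pow_div_factorial]
    simpa using (FloorSemiring.tendsto_pow_div_factorial_atTop c).mul_const (c ^ s / s.factorial)

theorem tendsto_measureReal_lt_of_tendsto_integral_choose [∀ i, IsFiniteMeasure (P i)]
    (hW : ∀ᶠ i in l, ∀ r, Integrable (fun ω => ((W i ω).choose r : ℝ)) (P i))
    (hlim : ∀ r, Tendsto (fun i => ∫ ω, ((W i ω).choose r : ℝ) ∂P i) l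
      (𝓝 (c ^ r / r.factorial))) (k : ℕ) :
    Tendsto (fun i => (P i).real {ω | W i ω < k}) l
      (𝓝 (Real.exp (-c) * ∑ s ∈ Finset.range k, c ^ s / s.factorial)) := by
  rw [Finset.mul_sum]
  refine (tendsto_finsetSum _ fun s _ =>
    tendsto_measureReal_eq_of_tendsto_integral_choose hW hlim s).congr' ?_
  filter_upwards [hW] with i hi
  have hunion : {ω | W i ω < k} = ⋃ s ∈ Finset.range k, {ω | W i ω = s} := by
    ext ω
    simp
  rw [hunion, measureReal_biUnion_finset₀ _ fun s _ =>
    nullMeasurableSet_eq_of_integrable_choose hi s]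
  exact fun s _ t _ hst =>
    (Set.disjoint_left.2 fun ω hs ht => hst (hs.symm.trans ht)).aedisjoint

end BinomialMoments

section Counting

variable {ι Ω : Type*} {A : ι → Ω → Prop}

theorem choose_card_filter_eq_sum_indicator [∀ j ω, Decidable (A j ω)] (I : Finset ι) (r : ℕ)
    (ω : Ω) :
    (((I.filter (A · ω)).card.choose r : ℕ) : ℝ) =
      ∑ T ∈ I.powersetCard r, {ω | ∀ j ∈ T, A j ω}.indicator 1 ω := by
  classical
  have hfilter : (I.filter (A · ω)).powersetCard r =
      (I.powersetCard r).filter fun T => ∀ j ∈ T, A j ω := by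
    ext T
    simp only [Finset.mem_powersetCard, Finset.mem_filter, Finset.subset_iff]
    grind
  rw [← Finset.card_powersetCard, hfilter, Finset.card_filter, Nat.cast_sum]
  simp only [Set.indicator_apply, Set.mem_ofPred_eq, Nat.cast_ite, Nat.cast_one, Nat.cast_zero,
    Pi.one_apply]

variable [MeasurableSpace Ω] {μ : Measure Ω}

theorem nullMeasurableSet_forall_mem (hA : ∀ j, NullMeasurableSet {ω | A j ω} μ) (T : Finset ι) :
    NullMeasurableSet {ω | ∀ j ∈ T, A j ω} μ := by
  simpa only [Set.ofPred_forall] using T.nullMeasurableSet_biInter fun j _ => hA j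

variable [IsFiniteMeasure μ] [∀ j ω, Decidable (A j ω)]

theorem integrable_choose_card_filter (hA : ∀ j, NullMeasurableSet {ω | A j ω} μ) (I : Finset ι)
    (r : ℕ) : Integrable (fun ω => ((I.filter (A · ω)).card.choose r : ℝ)) μ := by
  simp only [choose_card_filter_eq_sum_indicator]
  exact integrable_finsetSum _ fun T _ =>
    (integrable_const (1 : ℝ)).indicator₀ (nullMeasurableSet_forall_mem hA T)

theorem integral_choose_card_filter (hA : ∀ j, NullMeasurableSet {ω | A j ω} μ) (I : Finset ι)
    (r : ℕ) : ∫ ω, ((I.filter (A · ω)).card.choose r : ℝ) ∂μ =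
      ∑ T ∈ I.powersetCard r, μ.real {ω | ∀ j ∈ T, A j ω} := by
  have hT := nullMeasurableSet_forall_mem hA
  simp only [choose_card_filter_eq_sum_indicator, ← integral_indicator_one₀ (hT _)]
  exact integral_finsetSum _ fun T _ => (integrable_const (1 : ℝ)).indicator₀ (hT T)

end Counting

section RunFree

variable {β : Type*} {T : Finset β} {m : ℕ} {y : ℕ → β}

/-- No letter of `T` is immediately repeated among the first `m` letters `y 0, …, y (m - 1)`. -/
def RunFree (T : Finset β) (m : ℕ) (y : ℕ → β) : Prop :=
  ∀ i, i + 1 < m → y i ∈ T → y (i + 1) ≠ y i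

theorem runFree_of_le_one (T : Finset β) (hm : m ≤ 1) (y : ℕ → β) : RunFree T m y :=
  fun _ hi => absurd hi (by omega)

theorem runFree_add_two_iff :
    RunFree T (m + 2) y ↔ RunFree T (m + 1) y ∧ ¬(y m ∈ T ∧ y (m + 1) = y m) := by
  simp only [RunFree, Nat.add_lt_add_iff_right, Nat.forall_lt_succ_right, not_and, ne_eq]

theorem runFree_add_one_iff_of_notMem (hy : y m ∉ T) : RunFree T (m + 1) y ↔ RunFree T m y := by
  rcases m with _ | m
  · simp only [RunFree, Nat.not_lt_zero, Nat.add_lt_add_iff_right, IsEmpty.forall_iff]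
  · rw [runFree_add_two_iff, and_iff_left fun ⟨hm, heq⟩ => hy (heq ▸ hm)]

theorem forall_mem_runFree_singleton_iff :
    (∀ j ∈ T, RunFree {j} m y) ↔ RunFree T m y := by
  simp only [RunFree, Finset.mem_singleton]
  grind

theorem dependsOn_runFree (T : Finset β) (m : ℕ) :
    DependsOn (RunFree T m) (Finset.range m : Set ℕ) := by
  intro y y' h
  refine propext (forall₂_congr fun i hi => ?_)
  rw [h i (by simp; omega), h (i + 1) (by simpa)]

end RunFree

section DependsOn

variable {ι β Ω : Type*} [MeasurableSpace β] [MeasurableSingletonClass β] [MeasurableSpace Ω]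
  {μ : Measure Ω}

theorem measureReal_inter_preimage_finset [IsFiniteMeasure μ] {E : Set Ω}
    (hE : NullMeasurableSet E μ) {f : Ω → β} (hf : AEMeasurable f μ) (T : Finset β) :
    μ.real (E ∩ f ⁻¹' T) = ∑ j ∈ T, μ.real (E ∩ f ⁻¹' {j}) := by
  have hunion : E ∩ f ⁻¹' T = ⋃ j ∈ T, E ∩ f ⁻¹' {j} := by
    ext ω
    simp
  rw [hunion, measureReal_biUnion_finset₀ _ fun j _ =>
    hE.inter (hf.nullMeasurable (measurableSet_singleton j))]
  exact fun j _ j' _ hj =>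
    (Set.disjoint_left.2 fun ω h h' => hj (h.2.symm.trans h'.2)).aedisjoint

variable [Countable β] {Y : ι → Ω → β} {Q : (ι → β) → Prop} {S : Finset ι}

theorem nullMeasurableSet_of_dependsOn (hY : ∀ i, AEMeasurable (Y i) μ) (hQ : DependsOn Q S) :
    NullMeasurableSet {ω | Q (Y · ω)} μ := by
  obtain ⟨g, rfl⟩ := dependsOn_iff_exists_comp.1 hQ
  exact (aemeasurable_pi_lambda (fun ω (i : S) => Y i ω) fun i => hY i).nullMeasurable
    (MeasurableSet.of_discrete (s := {v | g v}))

theorem measureReal_inter_preimage_of_dependsOn (hY : ∀ i, AEMeasurable (Y i) μ)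
    (hindep : iIndepFun Y μ) (hQ : DependsOn Q S) {i : ι} (hi : i ∉ S) (B : Set β) :
    μ.real ({ω | Q (Y · ω)} ∩ Y i ⁻¹' B) = μ.real {ω | Q (Y · ω)} * μ.real (Y i ⁻¹' B) := by
  obtain ⟨g, rfl⟩ := dependsOn_iff_exists_comp.1 hQ
  have h := hindep.indepFun_finset₀ S {i} (Finset.disjoint_singleton_right.2 hi) hY
  have := h.measure_inter_preimage_eq_mul {v | g v} {v | v ⟨i, Finset.mem_singleton_self i⟩ ∈ B}
    .of_discrete .of_discrete
  simp only [measureReal_def, ← ENNReal.toReal_mul]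
  exact congrArg ENNReal.toReal this

variable {T : Finset β} {p : ℝ}

theorem measureReal_and_mem_and_repeat (hY : ∀ i, AEMeasurable (Y i) μ) (hindep : iIndepFun Y μ)
    (hQ : DependsOn Q S) {i i' : ι} (hi : i ∈ S) (hi' : i' ∉ S)
    (hp : ∀ j ∈ T, μ.real (Y i' ⁻¹' {j}) = p) :
    μ.real {ω | Q (Y · ω) ∧ Y i ω ∈ T ∧ Y i' ω = Y i ω} =
      p * μ.real {ω | Q (Y · ω) ∧ Y i ω ∈ T} := by
  have := hindep.isProbabilityMeasure
  have hQm := nullMeasurableSet_of_dependsOn hY hQ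
  have hrepeat : NullMeasurableSet {ω | Q (Y · ω) ∧ Y i' ω = Y i ω} μ :=
    hQm.inter (nullMeasurableSet_eq_fun (hY i') (hY i))
  calc μ.real {ω | Q (Y · ω) ∧ Y i ω ∈ T ∧ Y i' ω = Y i ω}
      = μ.real ({ω | Q (Y · ω) ∧ Y i' ω = Y i ω} ∩ Y i ⁻¹' T) := by
        congr 1
        ext ω
        exact ⟨fun h => ⟨⟨h.1, h.2.2⟩, h.2.1⟩, fun h => ⟨h.1.1, h.2, h.1.2⟩⟩
    _ = ∑ j ∈ T, μ.real ({ω | Q (Y · ω) ∧ Y i' ω = Y i ω} ∩ Y i ⁻¹' {j}) :=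
        measureReal_inter_preimage_finset hrepeat (hY i) T
    _ = ∑ j ∈ T, μ.real ({ω | Q (Y · ω) ∧ Y i ω = j} ∩ Y i' ⁻¹' {j}) := by
        refine Finset.sum_congr rfl fun j _ => congrArg μ.real (Set.ext fun ω => ?_)
        simp only [Set.mem_inter_iff, Set.mem_ofPred_eq, Set.mem_preimage, Set.mem_singleton_iff]
        grind
    _ = ∑ j ∈ T, p * μ.real ({ω | Q (Y · ω)} ∩ Y i ⁻¹' {j}) := by
        refine Finset.sum_congr rfl fun j hj => ?_
        have hQj : DependsOn (fun y : ι → β => Q y ∧ y i = j) S := fun y y' h => by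
          simp only [hQ h, h i hi]
        rw [measureReal_inter_preimage_of_dependsOn hY hindep hQj hi', hp j hj, mul_comm]
        rfl
    _ = p * μ.real {ω | Q (Y · ω) ∧ Y i ω ∈ T} := by
        rw [← Finset.mul_sum, ← measureReal_inter_preimage_finset hQm (hY i)]
        rfl

end DependsOn

section RunFreeProb

/-- The probability that none of `r` given letters is immediately repeated among the first `m`
of a sequence of independent letters, when each of the `r` letters has probability `p`. It is
encoded by the second-order recurrence which it satisfies, see `measureReal_runFree`. -/
def runFreeProb (p : ℝ) (r : ℕ) : ℕ → ℝ
  | 0 => 1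
  | 1 => 1
  | m + 2 => (1 - p) * runFreeProb p r (m + 1) + p * (1 - r * p) * runFreeProb p r m

variable {β Ω : Type*} [Countable β] [MeasurableSpace β] [MeasurableSingletonClass β]
  [MeasurableSpace Ω] {μ : Measure Ω} {Y : ℕ → Ω → β} {T : Finset β} {p : ℝ}

theorem measureReal_runFree_and_mem (hY : ∀ i, AEMeasurable (Y i) μ) (hindep : iIndepFun Y μ)
    (hp : ∀ i, ∀ j ∈ T, μ.real (Y i ⁻¹' {j}) = p) (m : ℕ) :
    μ.real {ω | RunFree T (m + 1) (Y · ω) ∧ Y m ω ∈ T} =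
      μ.real {ω | RunFree T (m + 1) (Y · ω)} -
        (1 - T.card * p) * μ.real {ω | RunFree T m (Y · ω)} := by
  have := hindep.isProbabilityMeasure
  have hmem : NullMeasurableSet (Y m ⁻¹' T) μ := (hY m).nullMeasurable T.measurableSet
  have hcompl : μ.real (Y m ⁻¹' (T : Set β)ᶜ) = 1 - T.card * p := by
    have hT := measureReal_inter_preimage_finset nullMeasurableSet_univ (hY m) T
    simp only [Set.univ_inter, Finset.sum_congr rfl (hp m), Finset.sum_const, nsmul_eq_mul] at hT
    rw [Set.preimage_compl, probReal_compl_eq_one_sub₀ hmem, hT]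
  have hdiff : {ω | RunFree T (m + 1) (Y · ω)} \ Y m ⁻¹' T =
      {ω | RunFree T m (Y · ω)} ∩ Y m ⁻¹' (T : Set β)ᶜ :=
    Set.ext fun ω => and_congr_left fun h => runFree_add_one_iff_of_notMem h
  have hsplit := measureReal_inter_add_sdiff₀ (s := {ω | RunFree T (m + 1) (Y · ω)}) hmem
  rw [hdiff, measureReal_inter_preimage_of_dependsOn hY hindep (dependsOn_runFree T m)
    Finset.notMem_range_self, hcompl, mul_comm] at hsplit
  exact eq_sub_of_add_eq hsplit

theorem measureReal_runFree (hY : ∀ i, AEMeasurable (Y i) μ) (hindep : iIndepFun Y μ)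
    (hp : ∀ i, ∀ j ∈ T, μ.real (Y i ⁻¹' {j}) = p) (m : ℕ) :
    μ.real {ω | RunFree T m (Y · ω)} = runFreeProb p T.card m := by
  have := hindep.isProbabilityMeasure
  induction m using Nat.twoStepInduction with
  | zero => simp [runFree_of_le_one, runFreeProb]
  | one => simp [runFree_of_le_one, runFreeProb]
  | more m ih0 ih1 =>
    have hrepeat : NullMeasurableSet {ω | Y m ω ∈ T ∧ Y (m + 1) ω = Y m ω} μ :=
      ((hY m).nullMeasurable T.measurableSet).inter
        (nullMeasurableSet_eq_fun (hY (m + 1)) (hY m))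
    have hsplit := measureReal_inter_add_sdiff₀ (s := {ω | RunFree T (m + 1) (Y · ω)}) hrepeat
    have hdiff : {ω | RunFree T (m + 1) (Y · ω)} \ {ω | Y m ω ∈ T ∧ Y (m + 1) ω = Y m ω} =
        {ω | RunFree T (m + 2) (Y · ω)} :=
      Set.ext fun ω => runFree_add_two_iff.symm
    have hinter := measureReal_and_mem_and_repeat hY hindep (dependsOn_runFree T (m + 1))
      (Finset.self_mem_range_succ m) Finset.notMem_range_self (hp (m + 1))
    rw [measureReal_runFree_and_mem hY hindep hp, ih0, ih1] at hinter
    rw [hdiff, ← Set.ofPred_and, hinter, ih1] at hsplit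
    rw [runFreeProb]
    linarith

end RunFreeProb

section Bounds

theorem le_of_le_recurrence {R : Type*} [Semiring R] [PartialOrder R] [IsOrderedRing R] {a b : R}
    (ha : 0 ≤ a) (hb : 0 ≤ b) {u v : ℕ → R} (h0 : u 0 ≤ v 0) (h1 : u 1 ≤ v 1)
    (hu : ∀ m, u (m + 2) ≤ a * u (m + 1) + b * u m)
    (hv : ∀ m, a * v (m + 1) + b * v m ≤ v (m + 2)) (m : ℕ) : u m ≤ v m := by
  induction m using Nat.twoStepInduction with
  | zero => exact h0
  | one => exact h1
  | more m ih0 ih1 => exact (hu m).trans (le_trans (by gcongr) (hv m))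

variable {p : ℝ} {r : ℕ}

theorem pow_le_runFreeProb (hp : 0 ≤ p) (hp1 : p ≤ 1) (hrp : r * p ≤ 1) (m : ℕ) :
    (1 - r * p ^ 2) ^ m ≤ runFreeProb p r m := by
  have hρ : 0 ≤ 1 - r * p ^ 2 := by nlinarith
  refine le_of_le_recurrence (v := runFreeProb p r) (sub_nonneg.2 hp1)
    (mul_nonneg hp (sub_nonneg.2 hrp)) ?_ ?_ (fun m => ?_) (fun m => ?_) m
  · simp [runFreeProb]
  · simpa [runFreeProb] using by positivity
  · have hchar : (1 - r * p ^ 2) ^ 2 ≤ (1 - p) * (1 - r * p ^ 2) + p * (1 - r * p) := by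
      have : 0 ≤ (r * p ^ 3) * (1 - r * p) := mul_nonneg (by positivity) (sub_nonneg.2 hrp)
      linarith
    calc (1 - r * p ^ 2) ^ (m + 2) = (1 - r * p ^ 2) ^ 2 * (1 - r * p ^ 2) ^ m := by ring
      _ ≤ ((1 - p) * (1 - r * p ^ 2) + p * (1 - r * p)) * (1 - r * p ^ 2) ^ m := by gcongr
      _ = _ := by ring
  · rw [runFreeProb]

theorem runFreeProb_le_pow (hp : 0 ≤ p) (hp1 : p ≤ 1) (hrp : r * p ≤ 1) (m : ℕ) :
    (1 - r * p ^ 2 / (1 + p)) * runFreeProb p r m ≤ (1 - r * p ^ 2 / (1 + p)) ^ m := by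
  set δ := r * p ^ 2 / (1 + p)
  have hδp : δ * (1 + p) = r * p ^ 2 := div_mul_cancel₀ _ (by positivity)
  have hδ0 : 0 ≤ δ := by positivity
  have hδ1 : δ ≤ 1 := (div_le_one (by positivity)).2 (by nlinarith)
  refine le_of_le_recurrence (u := fun m => (1 - δ) * runFreeProb p r m)
    (sub_nonneg.2 hp1) (mul_nonneg hp (sub_nonneg.2 hrp)) ?_ ?_ (fun m => ?_) (fun m => ?_) m
  · simpa [runFreeProb] using hδ0
  · simp [runFreeProb]
  · simp only [runFreeProb]
    linarith
  · have hchar : (1 - p) * (1 - δ) + p * (1 - r * p) ≤ (1 - δ) ^ 2 := by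
      nlinarith [sq_nonneg δ]
    have : 0 ≤ 1 - δ := sub_nonneg.2 hδ1
    calc (1 - p) * (1 - δ) ^ (m + 1) + p * (1 - r * p) * (1 - δ) ^ m
        = ((1 - p) * (1 - δ) + p * (1 - r * p)) * (1 - δ) ^ m := by ring
      _ ≤ (1 - δ) ^ 2 * (1 - δ) ^ m := by gcongr
      _ = _ := by ring

end Bounds

section Asymptotics

theorem tendsto_exp_mul_one_sub_pow {ι : Type*} {l : Filter ι} {a b : ι → ℝ} {m : ι → ℕ} {ℓ : ℝ}
    (ha : Tendsto a l (𝓝 0)) (hba : Tendsto (fun i => b i * a i) l (𝓝 0))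
    (hm : Tendsto (fun i => b i - m i * a i) l (𝓝 ℓ)) :
    Tendsto (fun i => Real.exp (b i) * (1 - a i) ^ m i) l (𝓝 (Real.exp ℓ)) := by
  have hsmall : ∀ᶠ i in l, |a i| < 1 / 2 :=
    ha.abs.eventually_lt_const (by simp)
  have hlog : Tendsto (fun i => m i * (a i + Real.log (1 - a i))) l (𝓝 0) := by
    have hma : Tendsto (fun i => 2 * (b i * a i - (b i - m i * a i) * a i)) l (𝓝 0) := by
      simpa using (hba.sub (hm.mul ha)).const_mul 2
    refine squeeze_zero_norm' (hsmall.mono fun i hi => ?_) hma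
    have hbound := Real.abs_log_sub_add_sum_range_le (hi.trans (by norm_num)) 1
    simp only [Finset.sum_range_one, zero_add, pow_one, Nat.cast_zero, div_one,
      one_add_one_eq_two, sq_abs] at hbound
    rw [Real.norm_eq_abs, abs_mul, Nat.abs_cast]
    calc (m i : ℝ) * |a i + Real.log (1 - a i)| ≤ m i * (a i ^ 2 / (1 - |a i|)) := by gcongr
      _ ≤ m i * (a i ^ 2 / (1 / 2)) := by gcongr; linarith
      _ = 2 * (b i * a i - (b i - m i * a i) * a i) := by ring
  have hexp := (Real.continuous_exp.tendsto _).comp (hm.add hlog)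
  rw [add_zero] at hexp
  refine hexp.congr' ?_
  filter_upwards [hsmall] with i hi
  have hpos : 0 < 1 - a i := by linarith [le_abs_self (a i)]
  rw [Function.comp_apply, ← Real.exp_log (pow_pos hpos (m i)), ← Real.exp_add, Real.log_pow]
  ring_nf

theorem tendsto_add_log_div_add_atTop (x b : ℝ) :
    Tendsto (fun n : ℕ => (x + Real.log n) / ((n : ℝ) + b)) atTop (𝓝 0) := by
  have h1 := (Real.tendsto_pow_log_div_mul_add_atTop 1 b 1 one_ne_zero).comp
    (tendsto_natCast_atTop_atTop (R := ℝ))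
  have h0 := ((Real.tendsto_pow_log_div_mul_add_atTop 1 b 0 one_ne_zero).const_mul x).comp
    (tendsto_natCast_atTop_atTop (R := ℝ))
  simpa [Function.comp_def, div_eq_mul_inv, add_mul] using h0.add h1

theorem tendsto_natCast_add_atTop (c : ℝ) : Tendsto (fun n : ℕ => (n : ℝ) + c) atTop atTop :=
  tendsto_atTop_add_const_right _ c tendsto_natCast_atTop_atTop

theorem tendsto_sq_mul_add_log_atTop (x : ℝ) :
    Tendsto (fun n : ℕ => (n : ℝ) ^ 2 * (x + Real.log n)) atTop atTop :=
  ((tendsto_pow_atTop two_ne_zero).comp tendsto_natCast_atTop_atTop).atTop_mul_atTop₀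
    (tendsto_atTop_add_const_left _ x (Real.tendsto_log_atTop.comp tendsto_natCast_atTop_atTop))

theorem tendsto_pow_mul_one_sub_pow_floor (x c : ℝ) (r : ℕ) :
    Tendsto (fun n : ℕ => (n : ℝ) ^ r *
        (1 - r / (n * (n + c))) ^ ⌊(n : ℝ) ^ 2 * (x + Real.log n)⌋₊) atTop
      (𝓝 (Real.exp (-x) ^ r)) := by
  set d : ℕ → ℝ := fun n => r / (n * (n + c))
  set u : ℕ → ℝ := fun n => (n : ℝ) ^ 2 * (x + Real.log n)
  have hd : Tendsto d atTop (𝓝 0) := tendsto_const_nhds.div_atTop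
    (tendsto_natCast_atTop_atTop.atTop_mul_atTop₀ (tendsto_natCast_add_atTop c))
  have hlogd : Tendsto (fun n : ℕ => r * Real.log n * d n) atTop (𝓝 0) := by
    have h := (tendsto_add_log_div_add_atTop 0 c).mul
      (tendsto_const_div_atTop_nhds_zero_nat (r * r : ℝ))
    rw [zero_mul] at h
    refine h.congr fun n => ?_
    simp only [d, div_eq_mul_inv, mul_inv]
    ring
  have hfloor : Tendsto (fun n => (u n - ⌊u n⌋₊) * d n) atTop (𝓝 0) := by
    refine squeeze_zero_norm' ?_ (by simpa using hd.abs)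
    filter_upwards [(tendsto_sq_mul_add_log_atTop x).eventually_ge_atTop 0] with n hu
    have h1 : |u n - ⌊u n⌋₊| ≤ 1 := by
      rw [abs_le]
      constructor <;> linarith [Nat.floor_le hu, Nat.lt_floor_add_one (u n)]
    rw [norm_mul]
    exact mul_le_of_le_one_left (norm_nonneg _) h1
  have hmain : Tendsto (fun n : ℕ => r * Real.log n - ⌊u n⌋₊ * d n) atTop (𝓝 (r * -x)) := by
    have h := (((tendsto_add_log_div_add_atTop x c).const_mul (r * c)).add hfloor).const_add
      (r * -x)
    rw [mul_zero, add_zero, add_zero] at h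
    refine h.congr' ?_
    filter_upwards [eventually_gt_atTop 0, (tendsto_natCast_add_atTop c).eventually_gt_atTop 0]
      with n hn hnc
    simp only [u, d]
    field_simp
    ring
  rw [← Real.exp_nat_mul]
  refine (tendsto_exp_mul_one_sub_pow hd hlogd hmain).congr' ?_
  filter_upwards [eventually_gt_atTop 0] with n hn
  rw [Real.exp_nat_mul, Real.exp_log (by exact_mod_cast hn)]

theorem tendsto_pow_mul_runFreeProb (x : ℝ) (r : ℕ) :
    Tendsto (fun n : ℕ => (n : ℝ) ^ r *
        runFreeProb (1 / n) r ⌊(n : ℝ) ^ 2 * (x + Real.log n)⌋₊) atTop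
      (𝓝 (Real.exp (-x) ^ r)) := by
  have hδ : Tendsto (fun n : ℕ => 1 - r / ((n : ℝ) * (n + 1))) atTop (𝓝 1) := by
    simpa using (tendsto_const_nhds.div_atTop (tendsto_natCast_atTop_atTop.atTop_mul_atTop₀
      (tendsto_natCast_add_atTop 1))).const_sub (1 : ℝ)
  have hupper := (tendsto_pow_mul_one_sub_pow_floor x 1 r).div hδ one_ne_zero
  rw [div_one] at hupper
  refine tendsto_of_tendsto_of_tendsto_of_le_of_le' (tendsto_pow_mul_one_sub_pow_floor x 0 r)
    hupper ?_ ?_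
  all_goals
    filter_upwards [eventually_gt_atTop 0, eventually_ge_atTop r, hδ.eventually_const_lt one_pos]
      with n hn hrn hpos
    have hp1 : 1 / (n : ℝ) ≤ 1 := div_le_one_of_le₀ (by exact_mod_cast hn) (by positivity)
    have hrp : (r : ℝ) * (1 / n) ≤ 1 := by
      rw [mul_one_div]
      exact div_le_one_of_le₀ (by exact_mod_cast hrn) (by positivity)
  · have hlower : (r : ℝ) / (n * (n + 0)) = r * (1 / n) ^ 2 := by
      field_simp
      ring
    rw [hlower]
    gcongr
    exact pow_le_runFreeProb (by positivity) hp1 hrp _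
  · have hupper : (r : ℝ) / (n * (n + 1)) = r * (1 / n) ^ 2 / (1 + 1 / n) := by
      field_simp
    rw [Pi.div_apply, le_div_iff₀ hpos, mul_assoc, mul_comm (runFreeProb _ _ _), hupper]
    gcongr
    exact runFreeProb_le_pow (by positivity) hp1 hrp _

theorem tendsto_choose_mul_runFreeProb (x : ℝ) (r : ℕ) :
    Tendsto (fun n : ℕ => n.choose r *
        runFreeProb (1 / n) r ⌊(n : ℝ) ^ 2 * (x + Real.log n)⌋₊) atTop
      (𝓝 (Real.exp (-x) ^ r / r.factorial)) := by
  refine ((isEquivalent_choose r).mul .refl).symm.tendsto_nhds ?_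
  refine ((tendsto_pow_mul_runFreeProb x r).div_const _).congr fun n => ?_
  simp only [Pi.mul_apply]
  ring

end Asymptotics

section NumMissing

theorem lt_pairTime_iff (z : ℕ → ℕ) (j m : ℕ) :
    (m : ℕ∞) < pairTime z j ↔ RunFree {j} m (fun i => z (i + 1)) := by
  rw [← not_le, pairTime_le_iff]
  constructor
  · intro h i him hi heq
    rw [Finset.mem_singleton] at hi
    exact h ⟨i + 2, him, by omega, hi, heq.trans hi⟩
  · rintro h ⟨k, hkm, hk, hprev, hlast⟩
    obtain ⟨i, rfl⟩ := Nat.exists_eq_add_of_le' hk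
    exact h i hkm (Finset.mem_singleton.2 hprev) (hlast.trans hprev.symm)

variable {Ω : Type*} [MeasurableSpace Ω] {μ : Measure Ω} {Z : ℕ → Ω → ℕ}

theorem nullMeasurableSet_lt_pairTime (hZ : ∀ i, AEMeasurable (Z (i + 1)) μ) (j m : ℕ) :
    NullMeasurableSet {ω | (m : ℕ∞) < pairTime (Z · ω) j} μ := by
  simp only [lt_pairTime_iff]
  exact nullMeasurableSet_of_dependsOn hZ (dependsOn_runFree {j} m)

theorem integrable_choose_numMissing [IsFiniteMeasure μ] (hZ : ∀ i, AEMeasurable (Z (i + 1)) μ)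
    (n m r : ℕ) : Integrable (fun ω => ((numMissing n m (Z · ω)).choose r : ℝ)) μ :=
  integrable_choose_card_filter (fun j => nullMeasurableSet_lt_pairTime hZ j m) _ r

theorem integral_choose_numMissing {p : ℝ} (hZ : ∀ i, AEMeasurable (Z (i + 1)) μ)
    (hindep : iIndepFun (fun i => Z (i + 1)) μ) {n : ℕ}
    (hp : ∀ i, ∀ j ∈ Finset.Icc 1 n, μ.real (Z (i + 1) ⁻¹' {j}) = p) (m r : ℕ) :
    ∫ ω, ((numMissing n m (Z · ω)).choose r : ℝ) ∂μ = n.choose r * runFreeProb p r m := by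
  have := hindep.isProbabilityMeasure
  have hterm : ∀ T ∈ (Finset.Icc 1 n).powersetCard r,
      μ.real {ω | ∀ j ∈ T, (m : ℕ∞) < pairTime (Z · ω) j} = runFreeProb p r m := by
    intro T hT
    obtain ⟨hTn, rfl⟩ := Finset.mem_powersetCard.1 hT
    simp only [lt_pairTime_iff, forall_mem_runFree_singleton_iff]
    exact measureReal_runFree hZ hindep (fun i j hj => hp i j (hTn hj)) m
  unfold numMissing
  rw [integral_choose_card_filter (fun j => nullMeasurableSet_lt_pairTime hZ j m),
    Finset.sum_congr rfl hterm, Finset.sum_const, Finset.card_powersetCard, Nat.card_Icc,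
    Nat.add_sub_cancel, nsmul_eq_mul]

end NumMissing

theorem measureReal_preimage_singleton_of_hasLaw_uniformOn {Ω α : Type*} [MeasurableSpace Ω]
    {μ : Measure Ω} [MeasurableSpace α] [MeasurableSingletonClass α] {X : Ω → α} {s : Finset α}
    (hX : HasLaw X (uniformOn (s : Set α)) μ) {j : α} (hj : j ∈ s) :
    μ.real (X ⁻¹' {j}) = 1 / s.card := by
  classical
  have h := uniformOn_apply_finset (s := s) (t := {j})
  rw [Finset.inter_singleton_of_mem hj, Finset.card_singleton, Finset.coe_singleton] at h
  rw [measureReal_def, ← Measure.map_apply_of_aemeasurable hX.aemeasurable (.singleton j),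
    hX.map_eq, h]
  simp

theorem tendsto_measureReal_kthMaxTime
    {Ω : ℕ → Type*} [∀ n, MeasurableSpace (Ω n)]
    {P : (n : ℕ) → Measure (Ω n)} [∀ n, IsProbabilityMeasure (P n)] {Z : (n : ℕ) → ℕ → Ω n → ℕ}
    (hlaw : ∀ n, 1 ≤ n → ∀ i, 1 ≤ i → HasLaw (Z n i) (uniformOn (Set.Icc 1 n)) (P n))
    (hindep : ∀ n, 1 ≤ n → iIndepFun (fun i : ℕ => Z n (i + 1)) (P n))
    {k : ℕ} (hk : 1 ≤ k) (x : ℝ) :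
    Tendsto (fun n : ℕ => (P n).real {ω | TimeLE
        (kthMaxTime n k (fun i => Z n i ω)) ((n : ℝ) ^ 2 * (x + Real.log n))}) atTop
      (𝓝 (Real.exp (-Real.exp (-x)) *
        ∑ s ∈ Finset.range k, Real.exp (-(s : ℝ) * x) / (s.factorial : ℝ))) := by
  set m : ℕ → ℕ := fun n => ⌊(n : ℝ) ^ 2 * (x + Real.log n)⌋₊
  have hZ (n : ℕ) (hn : 1 ≤ n) (i : ℕ) := (hlaw n hn (i + 1) i.succ_pos).aemeasurable
  have hunif (n : ℕ) (hn : 1 ≤ n) (i j : ℕ) (hj : j ∈ Finset.Icc 1 n) :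
      (P n).real (Z n (i + 1) ⁻¹' {j}) = 1 / n := by
    have h := hlaw n hn (i + 1) i.succ_pos
    rw [← Finset.coe_Icc] at h
    simpa using measureReal_preimage_singleton_of_hasLaw_uniformOn h hj
  have hint : ∀ᶠ n in atTop, ∀ r,
      Integrable (fun ω => ((numMissing n (m n) (Z n · ω)).choose r : ℝ)) (P n) := by
    filter_upwards [eventually_ge_atTop 1] with n hn
    exact integrable_choose_numMissing (hZ n hn) n (m n)
  have hmoment (r : ℕ) :
      Tendsto (fun n => ∫ ω, ((numMissing n (m n) (Z n · ω)).choose r : ℝ) ∂P n) atTop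
        (𝓝 (Real.exp (-x) ^ r / r.factorial)) := by
    refine (tendsto_choose_mul_runFreeProb x r).congr' ?_
    filter_upwards [eventually_ge_atTop 1] with n hn
    exact (integral_choose_numMissing (hZ n hn) (hindep n hn) (hunif n hn) (m n) r).symm
  have hexp (s : ℕ) : Real.exp (-(s : ℝ) * x) = Real.exp (-x) ^ s := by
    rw [← Real.exp_nat_mul, neg_mul_comm]
  simp only [hexp]
  refine (tendsto_measureReal_lt_of_tendsto_integral_choose hint hmoment k).congr' ?_
  filter_upwards [(tendsto_sq_mul_add_log_atTop x).eventually_ge_atTop 0, eventually_ge_atTop k]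
    with n hu hkn
  simp only [timeLE_iff hu, kthMaxTime_le_iff hk hkn, m]

end PairCollector

theorem theorem3p3
    {Ω : ℕ → Type*} [∀ n, MeasurableSpace (Ω n)]
    (P : (n : ℕ) → Measure (Ω n)) [∀ n, IsProbabilityMeasure (P n)]
    (Z : (n : ℕ) → ℕ → Ω n → ℕ)
    (hlaw : ∀ n, 1 ≤ n → ∀ i, 1 ≤ i → HasLaw (Z n i) (uniformOn (Set.Icc 1 n)) (P n))
    (hindep : ∀ n, 1 ≤ n → iIndepFun (fun i : ℕ => Z n (i + 1)) (P n))
    (k : ℕ) (hk : 1 ≤ k) :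
    (∀ n, k ≤ n → ∀ ω : Ω n,
      PairCollector.collectTime n (n + 1 - k) (fun i => Z n i ω) =
        PairCollector.kthMaxTime n k (fun i => Z n i ω)) ∧
    (∀ x : ℝ, Tendsto
      (fun n : ℕ => (P n).real {ω | PairCollector.TimeLE
        (PairCollector.kthMaxTime n k (fun i => Z n i ω)) ((n : ℝ) ^ 2 * (x + Real.log n))})
      atTop
      (𝓝 (Real.exp (-Real.exp (-x)) *
        ∑ s ∈ Finset.range k, Real.exp (-(s : ℝ) * x) / (s.factorial : ℝ)))) ∧
    (∀ n, 1 ≤ n → ∀ ω : Ω n,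
      PairCollector.collectTime n n (fun i => Z n i ω) =
        PairCollector.maxTime n (fun i => Z n i ω)) ∧
    (∀ x : ℝ, Tendsto
      (fun n : ℕ => (P n).real {ω | PairCollector.TimeLE
        (PairCollector.maxTime n (fun i => Z n i ω)) ((n : ℝ) ^ 2 * (x + Real.log n))})
      atTop (𝓝 (Real.exp (-Real.exp (-x))))) := by
  refine ⟨fun n hkn ω => PairCollector.collectTime_eq_kthMaxTime hk hkn _,
    PairCollector.tendsto_measureReal_kthMaxTime hlaw hindep hk, fun n hn ω => ?_, fun x => ?_⟩
  · rw [← PairCollector.kthMaxTime_one hn, ← PairCollector.collectTime_eq_kthMaxTime le_rfl hn,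
      Nat.add_sub_cancel]
  · have h := PairCollector.tendsto_measureReal_kthMaxTime hlaw hindep le_rfl x
    simp only [Finset.range_one, Finset.sum_singleton, Nat.cast_zero, neg_zero, zero_mul,
      Real.exp_zero, Nat.factorial_zero, Nat.cast_one, div_one, mul_one] at h
    refine h.congr' ?_
    filter_upwards [eventually_ge_atTop 1] with n hn
    simp only [PairCollector.kthMaxTime_one hn]
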